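/- Let $M$ be a matroid on a finite ground set $E$. For positive real weights $\mathbf{y}=(y_e)_{e\in E}$, a subset $S\subseteq E$ and an integer $j\ge 0$, put $$M_j(S,\mathbf{y})=\sum_{B}\ \prod_{e\in B}y_e ,$$ where the sum is over all bases $B$ of $M$ with $|B\cap S|=j$. For a positive integer $m$, say that $M$ satisfies $\sqrt{\mathrm{BLC}}[m]$ if for all weights $\mathbf{y}$ with $y_e>0$ for every $e\in E$, all $S\subseteq E$ with $|S|=n\le m$, and all $1\le j\le n-1$ such that $M_j(S,\mathbf{y})\neq 0$, $$M_j(S,\mathbf{y})^2>\left[1+\frac{1}{\min(j,n-j)}\right]M_{j-1}(S,\mathbf{y})\,M_{j+1}(S,\mathbf{y}).$$ Say that $M$ satisfies $\sqrt{\mathrm{BLC}}$ if it satisfies $\sqrt{\mathrm{BLC}}[m]$ for every positive integer $m$. **Theorem 5.2.** Every finite matroid of rank three, and every finite matroid of corank three (that is, whose dual matroid has rank three), satisfies $\sqrt{\mathrm{BLC}}$. -/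

import Mathlib

namespace Matroid

open Classical in
/-- For a matroid `M` on a finite ground set, real weights `y`, a finite set `S` and `j : ℕ`,
this is `M_j(S, y) = ∑_B ∏_{e ∈ B} y_e`, the sum over all bases `B` of `M` with `|B ∩ S| = j`. -/
noncomputable def weightedBaseSum {α : Type*} (M : Matroid α) [M.Finite]
    (S : Finset α) (j : ℕ) (y : α → ℝ) : ℝ :=
  ∑ B ∈ M.ground_finite.toFinset.powerset.filter
      (fun B : Finset α => M.IsBase (B : Set α) ∧ (B ∩ S).card = j),
    ∏ e ∈ B, y e

/-- The condition `√BLC[m]`: strict root-binomial logarithmic concavity, for all positive weights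
on the ground set and all subsets `S` of the ground set with at most `m` elements. -/
def SqrtBLCUpTo {α : Type*} (M : Matroid α) [M.Finite] (m : ℕ) : Prop :=
  ∀ y : α → ℝ, (∀ e ∈ M.E, 0 < y e) →
    ∀ S : Finset α, (S : Set α) ⊆ M.E → S.card ≤ m →
      ∀ j : ℕ, 1 ≤ j → j < S.card → M.weightedBaseSum S j y ≠ 0 →
        (1 + 1 / ((min j (S.card - j) : ℕ) : ℝ)) *
            (M.weightedBaseSum S (j - 1) y * M.weightedBaseSum S (j + 1) y)
          < M.weightedBaseSum S j y ^ 2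

/-- The condition `√BLC`: the condition `√BLC[m]` holds for every positive integer `m`. -/
def SqrtBLC {α : Type*} (M : Matroid α) [M.Finite] : Prop :=
  ∀ m : ℕ, 1 ≤ m → M.SqrtBLCUpTo m

end Matroid

/-! In rank three the stronger bound $3M_{j-1}M_{j+1}\le M_j^2$ holds. As the required factor is at
most 2 and $M_j\ne0$, strictness is then free. The bound at $j=2$ comes from a reverse
Cauchy–Schwarz inequality for the base generating cubic, proved by passing from local to global. The
derivative of the cubic at a nonloop $a$ is the edge form of a complete multipartite graph whose
parts come from the lines through $a$; this is a square minus a positive semidefinite form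
(`multipartite_mul_le_sq`). Oppenheim's trickle-down argument lifts these local inequalities to the
derivative along any positive vector (`quadForm_nonpos_of_quadForm_le`, `triForm_mul_le_sq`).

Complementing $S$ turns $j=2$ into $j=1$, and $M_{j+1}=0$ for $j\ge3$. Corank three follows by
duality, with inverted weights. -/

/-! ### Trickle-down for symmetric forms -/

/-- An eigenvector of `D⁻¹ A` with positive eigenvalue is constant, if `A` is nonnegative and
connected, `D` is the diagonal matrix of its row sums, and `A ≤ A D⁻¹ A` as quadratic forms. -/
theorem eq_of_eigenvector_of_quadForm_le {ι : Type*} [Fintype ι] (A : ι → ι → ℝ)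
    (symm : ∀ i j, A i j = A j i) (nonneg : ∀ i j, 0 ≤ A i j)
    (conn : ∀ i j, ∃ k, 0 < A i k ∧ 0 < A k j)
    (le : ∀ x : ι → ℝ, ∑ i, ∑ j, A i j * x i * x j ≤
      ∑ i, (∑ j, A i j * x j) ^ 2 / ∑ j, A i j)
    {l : ℝ} (hl : 0 < l) {x : ι → ℝ} (hx : ∀ i, ∑ j, A i j * x j = l * (∑ j, A i j) * x i)
    (i j : ι) : x i = x j := by
  have hd : ∀ i, 0 < ∑ j, A i j := fun i ↦ by
    obtain ⟨k, hk, -⟩ := conn i i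
    exact Finset.sum_pos' (fun j _ ↦ nonneg i j) ⟨k, Finset.mem_univ k, hk⟩
  have hq : ∑ i, ∑ j, A i j * x i * x j = l * ∑ i, (∑ j, A i j) * x i ^ 2 := by
    rw [Finset.mul_sum]
    refine Finset.sum_congr rfl fun i _ ↦ ?_
    have : ∑ j, A i j * x i * x j = x i * ∑ j, A i j * x j := by
      rw [Finset.mul_sum]; exact Finset.sum_congr rfl fun j _ ↦ by ring
    rw [this, hx]; ring
  have hr : ∑ i, (∑ j, A i j * x j) ^ 2 / ∑ j, A i j = l ^ 2 * ∑ i, (∑ j, A i j) * x i ^ 2 := by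
    rw [Finset.mul_sum]
    refine Finset.sum_congr rfl fun i _ ↦ ?_
    rw [hx]; field_simp [(hd i).ne']
  have hN : 0 ≤ ∑ i, (∑ j, A i j) * x i ^ 2 :=
    Finset.sum_nonneg fun i _ ↦ mul_nonneg (hd i).le (sq_nonneg _)
  have hle := le x
  rw [hq, hr] at hle
  -- At an eigenvector, `le` reads $lN\le l^2N$ with $N=\langle x,Dx\rangle$; divide by $l>0$.
  have hkey : (1 - l) * ∑ i, (∑ j, A i j) * x i ^ 2 ≤ 0 := by
    by_contra! h
    nlinarith [mul_pos hl h]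
  -- The Dirichlet energy is nonnegative, and `hkey` makes it nonpositive; so it vanishes and $x$ is
  -- constant along edges.
  have hdir : ∑ i, ∑ j, A i j * (x i - x j) ^ 2 =
      2 * ((1 - l) * ∑ i, (∑ j, A i j) * x i ^ 2) := by
    have e1 : ∑ i, ∑ j, A i j * x i ^ 2 = ∑ i, (∑ j, A i j) * x i ^ 2 :=
      Finset.sum_congr rfl fun i _ ↦ by rw [Finset.sum_mul]
    have e2 : ∑ i, ∑ j, A i j * x j ^ 2 = ∑ i, (∑ j, A i j) * x i ^ 2 := by
      rw [← e1, Finset.sum_comm]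
      exact Finset.sum_congr rfl fun i _ ↦ Finset.sum_congr rfl fun j _ ↦ by rw [symm]
    have e3 : ∑ i, ∑ j, A i j * (x i - x j) ^ 2 = ∑ i, ∑ j, A i j * x i ^ 2 +
        ∑ i, ∑ j, A i j * x j ^ 2 - 2 * ∑ i, ∑ j, A i j * x i * x j := by
      simp only [Finset.mul_sum, ← Finset.sum_add_distrib, ← Finset.sum_sub_distrib]
      exact Finset.sum_congr rfl fun i _ ↦ Finset.sum_congr rfl fun j _ ↦ by ring
    rw [e3, e1, e2, hq]; ring
  have hnn : ∀ i j, 0 ≤ A i j * (x i - x j) ^ 2 :=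
    fun i j ↦ mul_nonneg (nonneg i j) (sq_nonneg _)
  have hzero : ∑ i, ∑ j, A i j * (x i - x j) ^ 2 = 0 :=
    le_antisymm (by rw [hdir]; linarith)
      (Finset.sum_nonneg fun i _ ↦ Finset.sum_nonneg fun j _ ↦ hnn i j)
  have hadj : ∀ i j, 0 < A i j → x i = x j := fun i j hij ↦ by
    have h1 := (Finset.sum_eq_zero_iff_of_nonneg
      fun i _ ↦ Finset.sum_nonneg fun j _ ↦ hnn i j).1 hzero i (Finset.mem_univ i)
    have h2 := (Finset.sum_eq_zero_iff_of_nonneg fun j _ ↦ hnn i j).1 h1 j (Finset.mem_univ j)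
    have h3 := pow_eq_zero_iff two_ne_zero |>.1 ((mul_eq_zero.1 h2).resolve_left hij.ne')
    linarith
  obtain ⟨k, hik, hkj⟩ := conn i j
  exact (hadj i k hik).trans (hadj k j hkj)

/-- The trickle-down step: a nonnegative connected symmetric form with `A ≤ A D⁻¹ A`, where `D` is
the diagonal matrix of row sums, is negative semidefinite on the complement of the constants. -/
theorem quadForm_nonpos_of_quadForm_le {ι : Type*} [Fintype ι] (A : ι → ι → ℝ)
    (symm : ∀ i j, A i j = A j i) (nonneg : ∀ i j, 0 ≤ A i j)
    (conn : ∀ i j, ∃ k, 0 < A i k ∧ 0 < A k j)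
    (le : ∀ x : ι → ℝ, ∑ i, ∑ j, A i j * x i * x j ≤
      ∑ i, (∑ j, A i j * x j) ^ 2 / ∑ j, A i j)
    (x : ι → ℝ) (hx : ∑ i, (∑ j, A i j) * x i = 0) :
    ∑ i, ∑ j, A i j * x i * x j ≤ 0 := by
  classical
  have hd : ∀ i, 0 < ∑ j, A i j := fun i ↦ by
    obtain ⟨k, hk, -⟩ := conn i i
    exact Finset.sum_pos' (fun j _ ↦ nonneg i j) ⟨k, Finset.mem_univ k, hk⟩
  set s : ι → ℝ := fun i ↦ √(∑ j, A i j) with hs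
  have hs0 : ∀ i, 0 < s i := fun i ↦ Real.sqrt_pos.2 (hd i)
  have hss : ∀ i, s i * s i = ∑ j, A i j := fun i ↦ Real.mul_self_sqrt (hd i).le
  -- $B=D^{-1/2}AD^{-1/2}$ is symmetric, so the form can be diagonalised at $y=D^{1/2}x$.
  let B : Matrix ι ι ℝ := Matrix.of fun i j ↦ A i j / (s i * s j)
  have hB : B.IsHermitian := by
    ext i j
    simp [B, symm i j, mul_comm]
  let y : EuclideanSpace ℝ ι := WithLp.toLp 2 fun i ↦ s i * x i
  let By : EuclideanSpace ℝ ι := WithLp.toLp 2 (B.mulVec y.ofLp)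
  have hform : ∑ i, ∑ j, A i j * x i * x j = inner ℝ y By := by
    simp only [y, By, PiLp.inner_apply, Matrix.mulVec, dotProduct, B, Matrix.of_apply]
    refine Finset.sum_congr rfl fun i _ ↦ ?_
    simp only [RCLike.inner_apply, conj_trivial, Finset.sum_mul]
    refine Finset.sum_congr rfl fun j _ ↦ ?_
    have := (hs0 i).ne'
    have := (hs0 j).ne'
    field_simp
  rw [hform, ← hB.eigenvectorBasis.sum_inner_mul_inner]
  refine Finset.sum_nonpos fun k _ ↦ ?_
  set u := hB.eigenvectorBasis k with hu
  have hBu : B.mulVec u.ofLp = hB.eigenvalues k • u.ofLp := hB.mulVec_eigenvectorBasis k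
  have h1 : inner ℝ u By = hB.eigenvalues k * inner ℝ y u := by
    have : inner ℝ u By = dotProduct y.ofLp (B.mulVec u.ofLp) := by
      rw [EuclideanSpace.inner_eq_star_dotProduct]
      have hT : B.transpose = B := Matrix.isHermitian_iff_isSymm.1 hB
      simp only [By, star_trivial]
      rw [dotProduct_comm, Matrix.dotProduct_mulVec, ← Matrix.mulVec_transpose, hT,
        dotProduct_comm]
    rw [this, hBu, dotProduct_smul, EuclideanSpace.inner_eq_star_dotProduct]
    simp [dotProduct_comm]
  rw [h1]
  rcases le_or_gt (hB.eigenvalues k) 0 with hk | hk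
  · nlinarith [mul_nonneg (neg_nonneg.2 hk) (mul_self_nonneg (inner ℝ y u : ℝ))]
  -- $D^{-1/2}u$ is an eigenvector of $D^{-1}A$ with positive eigenvalue, hence constant; then `hx`
  -- says $y\perp u$.
  · have heig : ∀ i, ∑ j, A i j * (u j / s j) =
        hB.eigenvalues k * (∑ j, A i j) * (u i / s i) := fun i ↦ by
      have := congrFun hBu i
      simp only [Matrix.mulVec, dotProduct, B, Matrix.of_apply, Pi.smul_apply, smul_eq_mul] at this
      rw [← hss]
      have hsi := (hs0 i).ne'
      calc ∑ j, A i j * (u j / s j) = s i * ∑ j, A i j / (s i * s j) * u j := by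
            rw [Finset.mul_sum]
            refine Finset.sum_congr rfl fun j _ ↦ ?_
            have := (hs0 j).ne'
            field_simp
        _ = _ := by rw [this]; field_simp
    have hconst := eq_of_eigenvector_of_quadForm_le A symm nonneg conn le hk heig
    have h0 : inner ℝ y u = 0 := by
      simp only [PiLp.inner_apply, RCLike.inner_apply, conj_trivial, y]
      rcases isEmpty_or_nonempty ι with _ | ⟨⟨i₀⟩⟩
      · simp
      · calc ∑ i, u i * (s i * x i) = ∑ i, (u i₀ / s i₀) * ((∑ j, A i j) * x i) := by
              refine Finset.sum_congr rfl fun i _ ↦ ?_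
              rw [hconst i₀ i, ← hss]
              have := (hs0 i).ne'
              field_simp
          _ = 0 := by rw [← Finset.mul_sum, hx, mul_zero]
    rw [h0, zero_mul]

/-! ### Symmetric trilinear forms -/

/-- The trilinear form with coefficients `g`. -/
def triForm {ι : Type*} [Fintype ι] (g : ι → ι → ι → ℝ) (x y z : ι → ℝ) : ℝ :=
  ∑ a, ∑ b, ∑ c, g a b c * x a * y b * z c

/-- The hypothesis is the value of a quadratic form at $x-lv$. A single good $l$ suffices, since
$2lqr-l^2r^2=q^2-(q-lr)^2\le q^2$. -/
theorem mul_le_sq_of_nonpos {p q r : ℝ} (l : ℝ) (hr : 0 ≤ r)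
    (h : p - 2 * l * q + l ^ 2 * r ≤ 0) : r * p ≤ q ^ 2 := by
  nlinarith [sq_nonneg (q - l * r), mul_nonneg hr (neg_nonneg.2 h)]

section triForm

variable {ι : Type*} [Fintype ι] {g : ι → ι → ι → ℝ}

theorem triForm_swap_left (symm : ∀ a b c, g a b c = g b a c) (x y z : ι → ℝ) :
    triForm g x y z = triForm g y x z := by
  unfold triForm
  rw [Finset.sum_comm]
  refine Finset.sum_congr rfl fun a _ ↦ Finset.sum_congr rfl fun b _ ↦
    Finset.sum_congr rfl fun c _ ↦ ?_
  rw [symm]; ring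

theorem triForm_swap_right (symm : ∀ a b c, g a b c = g a c b) (x y z : ι → ℝ) :
    triForm g x y z = triForm g x z y := by
  unfold triForm
  refine Finset.sum_congr rfl fun a _ ↦ ?_
  rw [Finset.sum_comm]
  refine Finset.sum_congr rfl fun b _ ↦ Finset.sum_congr rfl fun c _ ↦ ?_
  rw [symm]; ring

theorem triForm_add_smul (x y z w : ι → ℝ) (s t : ℝ) :
    triForm g x y (s • z + t • w) = s * triForm g x y z + t * triForm g x y w := by
  simp only [triForm, Finset.mul_sum, ← Finset.sum_add_distrib]
  refine Finset.sum_congr rfl fun a _ ↦ Finset.sum_congr rfl fun b _ ↦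
    Finset.sum_congr rfl fun c _ ↦ ?_
  simp only [Pi.add_apply, Pi.smul_apply, smul_eq_mul]; ring

theorem triForm_eq_sum_mul (x y z : ι → ℝ) :
    triForm g x y z = ∑ a, x a * ∑ b, ∑ c, g a b c * y b * z c := by
  simp only [triForm, Finset.mul_sum]
  refine Finset.sum_congr rfl fun a _ ↦ Finset.sum_congr rfl fun b _ ↦
    Finset.sum_congr rfl fun c _ ↦ ?_
  ring

theorem triForm_add_smul_mid (symm : ∀ a b c, g a b c = g a c b) (x z w y : ι → ℝ) (s t : ℝ) :
    triForm g x (s • z + t • w) y = s * triForm g x z y + t * triForm g x w y := by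
  rw [triForm_swap_right symm, triForm_add_smul, triForm_swap_right symm x z,
    triForm_swap_right symm x w]

theorem triForm_add_smul_left (symm : ∀ a b c, g a b c = g b a c)
    (symm' : ∀ a b c, g a b c = g a c b) (z w x y : ι → ℝ) (s t : ℝ) :
    triForm g (s • z + t • w) x y = s * triForm g z x y + t * triForm g w x y := by
  rw [triForm_swap_left symm, triForm_add_smul_mid symm', triForm_swap_left symm x z,
    triForm_swap_left symm x w]

/-- If all partial derivatives of a connected nonnegative cubic form satisfy the reverse
Cauchy–Schwarz inequality, then so does its directional derivative along a positive vector. -/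
theorem triForm_mul_le_sq (symm₁ : ∀ a b c, g a b c = g b a c)
    (symm₂ : ∀ a b c, g a b c = g a c b) (nonneg : ∀ a b c, 0 ≤ g a b c)
    (conn : ∀ a b, ∃ c, (∃ d, 0 < g a c d) ∧ ∃ d, 0 < g c b d)
    (v : ι → ℝ) (hv : ∀ i, 0 < v i)
    (local_le : ∀ a, ∀ x : ι → ℝ, (∑ b, ∑ c, g a b c * v b * v c) *
      (∑ b, ∑ c, g a b c * x b * x c) ≤ (∑ b, ∑ c, g a b c * x b * v c) ^ 2)
    (x : ι → ℝ) : triForm g v v v * triForm g v x x ≤ triForm g v v x ^ 2 := by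
  -- Up to the factor $v_j$, this is the Hessian at $v$ weighted by $v_iv_j$. With this scaling the
  -- $i$-th local inequality, multiplied by $v_i$ and summed, is exactly $A\le AD^{-1}A$.
  let A : ι → ι → ℝ := fun i j ↦ v i * ∑ k, g i j k * v j * v k
  have hterm : ∀ a b c, 0 ≤ g a b c * v b * v c := fun a b c ↦
    mul_nonneg (mul_nonneg (nonneg a b c) (hv b).le) (hv c).le
  have hApos : ∀ i j, (∃ d, 0 < g i j d) → 0 < A i j := fun i j ⟨d, hd⟩ ↦
    mul_pos (hv i) (Finset.sum_pos' (fun k _ ↦ hterm i j k)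
      ⟨d, Finset.mem_univ d, mul_pos (mul_pos hd (hv j)) (hv d)⟩)
  have hAsymm : ∀ i j, A i j = A j i := fun i j ↦ by
    simp only [A, Finset.mul_sum]
    exact Finset.sum_congr rfl fun k _ ↦ by rw [symm₁]; ring
  have hAconn : ∀ i j, ∃ k, 0 < A i k ∧ 0 < A k j := fun i j ↦ by
    obtain ⟨c, h1, h2⟩ := conn i j
    exact ⟨c, hApos i c h1, hApos c j h2⟩
  have hAx : ∀ (y : ι → ℝ) i, ∑ j, A i j * y j = v i * ∑ j, ∑ k, g i j k * (v * y) j * v k :=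
    fun y i ↦ by
      simp only [A, Finset.mul_sum, Finset.sum_mul, Pi.mul_apply]
      exact Finset.sum_congr rfl fun j _ ↦ Finset.sum_congr rfl fun k _ ↦ by ring
  have hA1 : ∀ i, ∑ j, A i j = v i * ∑ j, ∑ k, g i j k * v j * v k := fun i ↦ by
    simpa using hAx 1 i
  have hpos : ∀ i, 0 < ∑ j, ∑ k, g i j k * v j * v k := fun i ↦ by
    obtain ⟨k, hk, -⟩ := hAconn i i
    have h : 0 < ∑ j, A i j :=
      Finset.sum_pos' (fun j _ ↦ mul_nonneg (hv i).le (Finset.sum_nonneg fun k _ ↦ hterm i j k))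
        ⟨k, Finset.mem_univ k, hk⟩
    rw [hA1] at h
    exact pos_of_mul_pos_right h (hv i).le
  have hAq : ∀ y : ι → ℝ, ∑ i, ∑ j, A i j * y i * y j = triForm g v (v * y) (v * y) := fun y ↦ by
    rw [triForm_swap_left symm₁, triForm_swap_right symm₂, triForm_eq_sum_mul]
    refine Finset.sum_congr rfl fun i _ ↦ ?_
    have : ∑ j, A i j * y i * y j = y i * ∑ j, A i j * y j := by
      rw [Finset.mul_sum]; exact Finset.sum_congr rfl fun j _ ↦ by ring
    rw [this, hAx, Pi.mul_apply]; ring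
  have hmain := quadForm_nonpos_of_quadForm_le A hAsymm
    (fun i j ↦ mul_nonneg (hv i).le (Finset.sum_nonneg fun k _ ↦ hterm i j k)) hAconn
    (fun y ↦ by
      rw [hAq, triForm_eq_sum_mul]
      refine Finset.sum_le_sum fun i _ ↦ ?_
      rw [hA1, hAx, le_div_iff₀ (mul_pos (hv i) (hpos i))]
      nlinarith [mul_le_mul_of_nonneg_left (local_le i (v * y)) (sq_nonneg (v i))])
  have hr₀ : 0 ≤ triForm g v v v := Finset.sum_nonneg fun a _ ↦ Finset.sum_nonneg fun b _ ↦
    Finset.sum_nonneg fun c _ ↦ mul_nonneg (mul_nonneg (mul_nonneg (nonneg a b c) (hv a).le)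
      (hv b).le) (hv c).le
  rcases hr₀.eq_or_lt with hr | hr
  · rw [← hr, zero_mul]; positivity
  refine mul_le_sq_of_nonpos (triForm g v v x / triForm g v v v) hr.le ?_
  set r := triForm g v v v with hrdef
  set q := triForm g v v x with hqdef
  -- Subtracting $q/r$ makes the vector $D$-orthogonal to the constants; in unscaled coordinates it
  -- is $x-(q/r)v$.
  have hvy : v * (fun i ↦ x i / v i - q / r) = (1 : ℝ) • x + (-(q / r)) • v := by
    ext i
    have := (hv i).ne'
    simp only [Pi.mul_apply, Pi.add_apply, Pi.smul_apply, smul_eq_mul]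
    field_simp
    ring
  have h := hmain (fun i ↦ x i / v i - q / r) (by
    have : ∀ i, (∑ j, A i j) * (x i / v i - q / r) =
        (v * fun i ↦ x i / v i - q / r) i * ∑ j, ∑ k, g i j k * v j * v k := fun i ↦ by
      rw [hA1, Pi.mul_apply]; ring
    rw [Finset.sum_congr rfl fun i _ ↦ this i, ← triForm_eq_sum_mul, hvy,
      triForm_add_smul_left symm₁ symm₂, triForm_swap_left symm₁, triForm_swap_right symm₂,
      ← hqdef, ← hrdef]
    field_simp
    ring)
  rw [hAq, hvy, triForm_add_smul, triForm_add_smul_mid symm₂, triForm_add_smul_mid symm₂,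
    triForm_swap_right symm₂ v x v, ← hqdef, ← hrdef] at h
  linarith

end triForm

/-! ### Complete multipartite graphs -/

/-- The kernel of an equivalence relation is positive semidefinite. -/
theorem sum_ite_eq_mul_nonneg {ι β : Type*} [Fintype ι] [DecidableEq β] (φ : ι → β) (u : ι → ℝ) :
    0 ≤ ∑ b, ∑ c, if φ b = φ c then u b * u c else 0 := by
  have h : ∑ b, ∑ c, (if φ b = φ c then u b * u c else 0) =
      ∑ t ∈ Finset.univ.image φ, (∑ b, if φ b = t then u b else 0) ^ 2 := by
    simp only [sq, Finset.sum_mul_sum]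
    symm
    rw [Finset.sum_comm]
    refine Finset.sum_congr rfl fun b _ ↦ ?_
    rw [Finset.sum_comm]
    refine Finset.sum_congr rfl fun c _ ↦ ?_
    rw [Finset.sum_eq_single (φ b)]
    · simp [eq_comm]
    · intro t _ ht
      simp [ht.symm]
    · intro h
      exact absurd (Finset.mem_image_of_mem φ (Finset.mem_univ b)) h
  rw [h]
  exact Finset.sum_nonneg fun t _ ↦ sq_nonneg _

/-- The generating form of a complete multipartite graph, where vertices with `C b = 0` are
isolated, satisfies the reverse Cauchy–Schwarz inequality. -/
theorem multipartite_mul_le_sq {ι β : Type*} [Fintype ι] [DecidableEq β] (k : ι → ι → ℝ)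
    (C : ι → ℝ) (φ : ι → β) (hk : ∀ b c, k b c = C b * C c * if φ b = φ c then 0 else 1)
    (v : ι → ℝ) (hv : 0 ≤ ∑ b, ∑ c, k b c * v b * v c) (x : ι → ℝ) :
    (∑ b, ∑ c, k b c * v b * v c) * (∑ b, ∑ c, k b c * x b * x c) ≤
      (∑ b, ∑ c, k b c * x b * v c) ^ 2 := by
  have hnonpos : ∀ u : ι → ℝ, ∑ b, C b * u b = 0 → ∑ b, ∑ c, k b c * u b * u c ≤ 0 :=
    fun u hu ↦ by
    -- All pairs minus the pairs within one part.
    have h : ∑ b, ∑ c, k b c * u b * u c = (∑ b, C b * u b) * (∑ b, C b * u b) -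
        ∑ b, ∑ c, if φ b = φ c then (C b * u b) * (C c * u c) else 0 := by
      rw [Finset.sum_mul_sum]
      simp only [← Finset.sum_sub_distrib]
      refine Finset.sum_congr rfl fun b _ ↦ Finset.sum_congr rfl fun c _ ↦ ?_
      rw [hk]
      split_ifs <;> ring
    rw [h, hu]
    linarith [sum_ite_eq_mul_nonneg φ fun b ↦ C b * u b]
  rcases hv.eq_or_lt with hr | hr
  · rw [← hr, zero_mul]; positivity
  have hV : ∑ b, C b * v b ≠ 0 := fun h ↦ (hnonpos v h).not_gt hr
  set l := (∑ b, C b * x b) / ∑ b, C b * v b with hl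
  have h := hnonpos (fun b ↦ x b - l * v b) (by
    simp only [mul_sub, mul_left_comm _ l, Finset.sum_sub_distrib, ← Finset.mul_sum]
    rw [hl, div_mul_cancel₀ _ hV, sub_self])
  refine mul_le_sq_of_nonpos l hr.le ?_
  have hsymm : ∑ b, ∑ c, k b c * v b * x c = ∑ b, ∑ c, k b c * x b * v c := by
    rw [Finset.sum_comm]
    refine Finset.sum_congr rfl fun b _ ↦ Finset.sum_congr rfl fun c _ ↦ ?_
    rw [hk, hk]
    simp only [eq_comm (a := φ c)]
    ring
  have hexp : ∑ b, ∑ c, k b c * (x b - l * v b) * (x c - l * v c) =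
      ∑ b, ∑ c, k b c * x b * x c - l * ∑ b, ∑ c, k b c * x b * v c -
      l * ∑ b, ∑ c, k b c * v b * x c + l ^ 2 * ∑ b, ∑ c, k b c * v b * v c := by
    simp only [Finset.mul_sum, ← Finset.sum_sub_distrib, ← Finset.sum_add_distrib]
    refine Finset.sum_congr rfl fun b _ ↦ Finset.sum_congr rfl fun c _ ↦ ?_
    ring
  rw [hexp, hsymm] at h
  linarith

/-! ### Bases of a rank-three matroid -/

namespace Matroid

variable {α : Type*} {M : Matroid α} {a b c : α}

theorem exists_notMem_closure_pair (hM : M.eRank = 3) (a b : α) :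
    ∃ c ∈ M.E, c ∉ M.closure {a, b} := by
  by_contra! h
  have h1 : M.eRank ≤ M.eRk {a, b} := by
    rw [← M.eRk_ground, ← M.eRk_closure_eq {a, b}]
    exact M.eRk_mono h
  have h2 := h1.trans ((M.eRk_le_encard _).trans (Set.encard_insert_le {b} a))
  rw [hM, Set.encard_singleton] at h2
  exact absurd h2 (by decide)

theorem isBase_triple_of_notMem_closure (hM : M.eRank = 3) (ha : M.IsNonloop a) (hb : b ∈ M.E)
    (hc : c ∈ M.E) (hab : b ∉ M.closure {a}) (habc : c ∉ M.closure {a, b}) :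
    M.IsBase {a, b, c} := by
  have hne : b ≠ a := by
    rintro rfl
    exact hab (M.mem_closure_of_mem rfl (by simpa using hb))
  have hI₂ : M.Indep {a, b} := by
    rw [Set.pair_comm, ha.indep.insert_indep_iff_of_notMem (by simpa using hne)]
    exact ⟨hb, hab⟩
  have hcm : c ∉ ({a, b} : Set α) := fun h ↦ habc (M.mem_closure_of_mem h hI₂.subset_ground)
  have hI₃ : M.Indep {a, b, c} := by
    have : ({a, b, c} : Set α) = insert c {a, b} := by
      ext; simp only [Set.mem_insert_iff, Set.mem_singleton_iff]; tauto
    rw [this, hI₂.insert_indep_iff_of_notMem hcm]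
    exact ⟨hc, habc⟩
  refine hI₃.isBase_of_eRk_ge (Set.toFinite _) ?_
  rw [hI₃.eRk_eq_encard, hM, Set.encard_eq_three.2]
  refine ⟨a, b, c, hne.symm, ?_, ?_, rfl⟩
  · rintro rfl; exact hcm (by simp)
  · rintro rfl; exact hcm (by simp)

/-- This exhibits the link of $a$ as complete multipartite: elements outside the closure of $a$ are
grouped by the line they span with $a$, and two of them complete a base exactly when the lines
differ. -/
theorem isBase_triple_iff (hM : M.eRank = 3) (ha : M.IsNonloop a) (hb : b ∈ M.E) (hc : c ∈ M.E) :
    M.IsBase {a, b, c} ↔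
      b ∉ M.closure {a} ∧ c ∉ M.closure {a} ∧ M.closure {a, b} ≠ M.closure {a, c} := by
  constructor
  · intro h
    have hcard : ({a, b, c} : Set α).encard = 3 := h.encard_eq_eRank.trans hM
    have hne : a ≠ b ∧ a ≠ c ∧ b ≠ c := by
      refine ⟨?_, ?_, ?_⟩ <;> rintro rfl
      · rw [Set.insert_eq_of_mem (by simp)] at hcard
        exact absurd (hcard.symm.trans_le (Set.encard_insert_le {c} a)) (by simp; decide)
      · rw [Set.insert_eq_of_mem (by simp)] at hcard
        exact absurd (hcard.symm.trans_le (Set.encard_insert_le {a} b)) (by simp; decide)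
      · rw [Set.pair_eq_singleton] at hcard
        exact absurd (hcard.symm.trans_le (Set.encard_insert_le {b} a)) (by simp; decide)
    obtain ⟨hab, hac, hbc⟩ := hne
    have hI := h.indep
    refine ⟨fun h' ↦ ?_, fun h' ↦ ?_, fun h' ↦ ?_⟩
    · refine hI.notMem_closure_sdiff_of_mem (e := b) (by simp) (M.closure_subset_closure ?_ h')
      simpa using hab
    · refine hI.notMem_closure_sdiff_of_mem (e := c) (by simp) (M.closure_subset_closure ?_ h')
      simpa using hac
    · have hcc : c ∈ M.closure {a, b} := by
        rw [h']; exact M.mem_closure_of_mem (by simp) (Set.insert_subset ha.mem_ground (by simpa))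
      refine hI.notMem_closure_sdiff_of_mem (e := c) (by simp) (M.closure_subset_closure ?_ hcc)
      simp [Set.insert_subset_iff, hac, hbc]
  · rintro ⟨hab, hac, hne⟩
    refine isBase_triple_of_notMem_closure hM ha hb hc hab fun h ↦ hne ?_
    have := M.closure_insert_congr (X := {a}) (e := c) (f := b) ⟨by rwa [Set.pair_comm], hac⟩
    rw [Set.pair_comm a b, Set.pair_comm a c]
    exact this.symm

open Classical in
/-- The indicator of `{a, b, c}` being a base. -/
noncomputable def baseIndicator (M : Matroid α) (a b c : α) : ℝ :=
  if M.IsBase {a, b, c} then 1 else 0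

theorem baseIndicator_nonneg (a b c : α) : 0 ≤ M.baseIndicator a b c := by
  unfold baseIndicator; split_ifs <;> norm_num

theorem baseIndicator_swap_left (a b c : α) : M.baseIndicator a b c = M.baseIndicator b a c := by
  unfold baseIndicator; rw [Set.insert_comm]

theorem baseIndicator_swap_right (a b c : α) : M.baseIndicator a b c = M.baseIndicator a c b := by
  unfold baseIndicator; rw [Set.pair_comm]

/-- A line does not cover the ground set, so any $c$ off the closure of $\{a,b\}$ is joined to both
$a$ and $b$. -/
theorem exists_baseIndicator_pos (hM : M.eRank = 3) {N : Finset α}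
    (hN : ∀ a, a ∈ N ↔ M.IsNonloop a) (a b : N) :
    ∃ c : N, (∃ d : N, 0 < M.baseIndicator a c d) ∧ ∃ d : N, 0 < M.baseIndicator c b d := by
  have key : ∀ a : N, ∀ c ∈ M.E, c ∉ M.closure {a.1} →
      ∃ d : N, 0 < M.baseIndicator a c d := fun a c hc hac ↦ by
    obtain ⟨d, hd, hd'⟩ := exists_notMem_closure_pair hM a.1 c
    have hB := isBase_triple_of_notMem_closure hM ((hN a).1 a.2) hc hd hac hd'
    refine ⟨⟨d, (hN d).2 (hB.indep.isNonloop_of_mem (by simp))⟩, ?_⟩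
    simp [baseIndicator, hB]
  obtain ⟨c, hc, hcab⟩ := exists_notMem_closure_pair hM a.1 b.1
  have hca : c ∉ M.closure {a.1} := fun h ↦ hcab (M.closure_subset_closure (by simp) h)
  have hcb : c ∉ M.closure {b.1} := fun h ↦ hcab (M.closure_subset_closure (by simp) h)
  have hcN : c ∈ N := (hN c).2 ⟨fun h ↦ hca (h.mem_closure _), hc⟩
  refine ⟨⟨c, hcN⟩, key a c hc hca, ?_⟩
  obtain ⟨d, hd⟩ := key b c hc hcb
  exact ⟨d, by rwa [baseIndicator_swap_left]⟩

theorem sum_baseIndicator_mul_le_sq (hM : M.eRank = 3) {N : Finset α}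
    (hN : ∀ a, a ∈ N ↔ M.IsNonloop a) (v : N → ℝ) (hv : ∀ i, 0 < v i) (a : N) (x : N → ℝ) :
    (∑ b : N, ∑ c : N, M.baseIndicator a b c * v b * v c) *
      (∑ b : N, ∑ c : N, M.baseIndicator a b c * x b * x c) ≤
      (∑ b : N, ∑ c : N, M.baseIndicator a b c * x b * v c) ^ 2 := by
  classical
  -- Elements parallel to $a$ get $C=0$: they are isolated in the link.
  refine multipartite_mul_le_sq (fun b c : N ↦ M.baseIndicator a b c)
    (fun b ↦ if b.1 ∈ M.closure {a.1} then 0 else 1) (fun b ↦ M.closure {a.1, b.1})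
    (fun b c ↦ ?_) v (Finset.sum_nonneg fun b _ ↦ Finset.sum_nonneg fun c _ ↦
      mul_nonneg (mul_nonneg (baseIndicator_nonneg _ _ _) (hv b).le) (hv c).le) x
  have := isBase_triple_iff hM ((hN a).1 a.2) ((hN b).1 b.2).mem_ground ((hN c).1 c.2).mem_ground
  unfold baseIndicator
  simp only [this]
  split_ifs <;> simp_all

/-- The reverse Cauchy–Schwarz inequality for the base generating form in rank three. -/
theorem triForm_baseIndicator_mul_le_sq (hM : M.eRank = 3) {N : Finset α}
    (hN : ∀ a, a ∈ N ↔ M.IsNonloop a) (v : N → ℝ) (hv : ∀ i, 0 < v i) (x : N → ℝ) :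
    triForm (fun a b c : N ↦ M.baseIndicator a b c) v v v *
      triForm (fun a b c : N ↦ M.baseIndicator a b c) v x x ≤
      triForm (fun a b c : N ↦ M.baseIndicator a b c) v v x ^ 2 :=
  triForm_mul_le_sq (g := fun a b c : N ↦ M.baseIndicator a b c)
    (fun a b c ↦ baseIndicator_swap_left a.1 b.1 c.1)
    (fun a b c ↦ baseIndicator_swap_right a.1 b.1 c.1) (fun a b c ↦ baseIndicator_nonneg a.1 b.1 c.1)
    (exists_baseIndicator_pos hM hN) v hv (fun a x ↦ sum_baseIndicator_mul_le_sq hM hN v hv a x) x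

end Matroid

/-! ### From the cubic form to the base sums -/

/-- Every three-element set has six orderings. -/
theorem sum_ordered_triples {α : Type*} [DecidableEq α] (N B : Finset α) (hB : B.card = 3)
    (hBN : B ⊆ N) (z : α → ℝ) :
    ∑ p ∈ (N ×ˢ N ×ˢ N).filter (fun p ↦ ({p.1, p.2.1, p.2.2} : Finset α) = B),
      z p.1 * z p.2.1 * z p.2.2 = 6 * ∏ e ∈ B, z e := by
  obtain ⟨p, q, r, hpq, hpr, hqr, rfl⟩ := Finset.card_eq_three.1 hB
  have hset : (N ×ˢ N ×ˢ N).filter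
      (fun x ↦ ({x.1, x.2.1, x.2.2} : Finset α) = {p, q, r}) =
      {(p, q, r), (p, r, q), (q, p, r), (q, r, p), (r, p, q), (r, q, p)} := by
    have hp : p ∈ N := hBN (by simp)
    have hq : q ∈ N := hBN (by simp)
    have hr : r ∈ N := hBN (by simp)
    ext ⟨x, y, w⟩
    simp only [Finset.mem_filter, Finset.mem_product, Finset.mem_insert, Finset.mem_singleton,
      Prod.mk.injEq]
    constructor
    · rintro ⟨-, h⟩
      have hx : x ∈ ({p, q, r} : Finset α) := h ▸ by simp
      have hy : y ∈ ({p, q, r} : Finset α) := h ▸ by simp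
      have hw : w ∈ ({p, q, r} : Finset α) := h ▸ by simp
      have hp' : p ∈ ({x, y, w} : Finset α) := h ▸ by simp
      have hq' : q ∈ ({x, y, w} : Finset α) := h ▸ by simp
      have hr' : r ∈ ({x, y, w} : Finset α) := h ▸ by simp
      simp only [Finset.mem_insert, Finset.mem_singleton] at hx hy hw hp' hq' hr'
      grind
    · rintro (⟨rfl, rfl, rfl⟩ | ⟨rfl, rfl, rfl⟩ | ⟨rfl, rfl, rfl⟩ | ⟨rfl, rfl, rfl⟩ |
        ⟨rfl, rfl, rfl⟩ | ⟨rfl, rfl, rfl⟩) <;> refine ⟨by simp [*], ?_⟩ <;> ext <;> simp <;> tauto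
  rw [hset]
  rw [Finset.sum_insert, Finset.sum_insert, Finset.sum_insert, Finset.sum_insert,
    Finset.sum_insert, Finset.sum_singleton, Finset.prod_insert, Finset.prod_insert,
    Finset.prod_singleton]
  · ring
  all_goals simp [hpq, hpr, hqr, hpq.symm, hpr.symm, hqr.symm]

namespace Matroid

variable {α : Type*} {M : Matroid α}

theorem IsBase.card_eq_three (hM : M.eRank = 3) {B : Finset α} (hB : M.IsBase (B : Set α)) :
    B.card = 3 := by
  have := hB.encard_eq_eRank.trans hM
  rw [Set.encard_coe_eq_coe_finsetCard] at this
  exact_mod_cast this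

open Classical in
/-- The diagonal of the base generating form is six times the base generating polynomial. -/
theorem triForm_baseIndicator_self (hM : M.eRank = 3) (N : Finset α) (z : α → ℝ) :
    triForm (fun a b c : N ↦ M.baseIndicator a b c) (fun a ↦ z a) (fun a ↦ z a) (fun a ↦ z a) =
      6 * ∑ B ∈ N.powerset.filter (fun B : Finset α ↦ M.IsBase (B : Set α)), ∏ e ∈ B, z e := by
  have h1 : triForm (fun a b c : N ↦ M.baseIndicator a b c)
      (fun a ↦ z a) (fun a ↦ z a) (fun a ↦ z a) =
      ∑ a ∈ N, ∑ b ∈ N, ∑ c ∈ N, M.baseIndicator a b c * z a * z b * z c := by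
    unfold triForm
    rw [← Finset.sum_coe_sort N]
    refine Finset.sum_congr rfl fun a _ ↦ ?_
    rw [← Finset.sum_coe_sort N]
    refine Finset.sum_congr rfl fun b _ ↦ ?_
    rw [← Finset.sum_coe_sort N]
  have h2 : ∑ a ∈ N, ∑ b ∈ N, ∑ c ∈ N, M.baseIndicator a b c * z a * z b * z c =
      ∑ p ∈ (N ×ˢ N ×ˢ N).filter (fun p ↦ M.IsBase {p.1, p.2.1, p.2.2}),
        z p.1 * z p.2.1 * z p.2.2 := by
    rw [Finset.sum_filter, Finset.sum_product]
    refine Finset.sum_congr rfl fun a _ ↦ ?_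
    rw [Finset.sum_product]
    refine Finset.sum_congr rfl fun b _ ↦ Finset.sum_congr rfl fun c _ ↦ ?_
    unfold baseIndicator
    split_ifs <;> ring
  rw [h1, h2, Finset.mul_sum]
  rw [← Finset.sum_fiberwise_of_maps_to (g := fun p ↦ ({p.1, p.2.1, p.2.2} : Finset α))
    (t := N.powerset.filter (fun B : Finset α ↦ M.IsBase (B : Set α)))]
  · refine Finset.sum_congr rfl fun B hB ↦ ?_
    rw [Finset.mem_filter, Finset.mem_powerset] at hB
    rw [← sum_ordered_triples N B (hB.2.card_eq_three hM) hB.1 z, Finset.filter_filter]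
    refine Finset.sum_congr (Finset.filter_congr fun p _ ↦ ?_) fun _ _ ↦ rfl
    constructor
    · exact fun h ↦ h.2
    · refine fun h ↦ ⟨?_, h⟩
      have := hB.2
      rw [← h] at this
      simpa using this
  · rintro ⟨a, b, c⟩ h
    simp only [Finset.mem_filter, Finset.mem_product, Finset.mem_powerset] at h ⊢
    refine ⟨?_, by simpa using h.2⟩
    simp [Finset.insert_subset_iff, h.1]

variable [M.Finite]

-- Scaling weights by $s$ on $S$ and by $t$ off it makes the $M_j$ the coefficients of a binary
-- cubic.
open Classical in
theorem sum_isBase_prod_ite (hM : M.eRank = 3) (S : Finset α) (y : α → ℝ) (s t : ℝ) :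
    ∑ B ∈ M.ground_finite.toFinset.powerset.filter (fun B : Finset α ↦ M.IsBase (B : Set α)),
      ∏ e ∈ B, (if e ∈ S then s * y e else t * y e) =
    ∑ j ∈ Finset.range 4, s ^ j * t ^ (3 - j) * M.weightedBaseSum S j y := by
  rw [← Finset.sum_fiberwise_of_maps_to (g := fun B ↦ (B ∩ S).card) (t := Finset.range 4)]
  · refine Finset.sum_congr rfl fun j _ ↦ ?_
    rw [weightedBaseSum, Finset.mul_sum, Finset.filter_filter]
    refine Finset.sum_congr (by congr) fun B hB ↦ ?_
    simp only [Finset.mem_filter] at hB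
    have hcard := Finset.card_inter_add_card_sdiff B S
    rw [hB.2.1.card_eq_three hM, hB.2.2] at hcard
    have e : ∀ e, (if e ∈ S then s * y e else t * y e) = (if e ∈ S then s else t) * y e :=
      fun e ↦ by split_ifs <;> rfl
    simp only [e, Finset.prod_mul_distrib, Finset.prod_ite, Finset.prod_const]
    rw [Finset.filter_mem_eq_inter, hB.2.2, Finset.filter_notMem_eq_sdiff,
      show (B \ S).card = 3 - j by omega]
  · intro B hB
    simp only [Finset.mem_filter, Finset.mem_range] at hB ⊢
    have := Finset.card_le_card (Finset.inter_subset_left (s₁ := B) (s₂ := S))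
    rw [hB.2.card_eq_three hM] at this
    omega

theorem weightedBaseSum_nonneg {y : α → ℝ} (hy : ∀ e ∈ M.E, 0 < y e) (S : Finset α) (j : ℕ) :
    0 ≤ M.weightedBaseSum S j y := by
  refine Finset.sum_nonneg fun B hB ↦ Finset.prod_nonneg fun e he ↦ (hy e ?_).le
  simp only [Finset.mem_filter] at hB
  exact hB.2.1.subset_ground he

theorem weightedBaseSum_eq_zero_of_lt (hM : M.eRank = 3) (S : Finset α) {j : ℕ} (hj : 3 < j)
    (y : α → ℝ) : M.weightedBaseSum S j y = 0 := by
  classical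
  rw [weightedBaseSum, Finset.sum_eq_zero]
  intro B hB
  simp only [Finset.mem_filter] at hB
  have := Finset.card_le_card (Finset.inter_subset_left (s₁ := B) (s₂ := S))
  rw [hB.2.1.card_eq_three hM] at this
  have h := hB.2.2
  exfalso
  convert absurd (h.symm.trans_le (le_trans (le_of_eq (by congr)) this)) (by omega)

/-! ### The inequality in rank three -/

/-- Ultra-log-concavity in rank three, at the top index. -/
theorem three_mul_weightedBaseSum_le_sq (hM : M.eRank = 3) {y : α → ℝ}
    (hy : ∀ e ∈ M.E, 0 < y e) (S : Finset α) :
    3 * (M.weightedBaseSum S 1 y * M.weightedBaseSum S 3 y) ≤ M.weightedBaseSum S 2 y ^ 2 := by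
  classical
  -- Loops lie in no base, and would break the connectivity that trickle-down needs.
  set N : Finset α := M.ground_finite.toFinset.filter M.IsNonloop with hNdef
  have hN : ∀ a, a ∈ N ↔ M.IsNonloop a := fun a ↦ by
    simp only [hNdef, Finset.mem_filter, Set.Finite.mem_toFinset, and_iff_right_iff_imp]
    exact fun h ↦ h.mem_ground
  have hbases : N.powerset.filter (fun B : Finset α ↦ M.IsBase (B : Set α)) =
      M.ground_finite.toFinset.powerset.filter (fun B : Finset α ↦ M.IsBase (B : Set α)) := by
    ext B
    simp only [Finset.mem_filter, Finset.mem_powerset, and_congr_left_iff]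
    refine fun hB ↦ ⟨fun h ↦ h.trans (Finset.filter_subset _ _), fun _ e he ↦ ?_⟩
    exact (hN e).2 (hB.indep.isNonloop_of_mem he)
  let g : N → N → N → ℝ := fun a b c ↦ M.baseIndicator a b c
  have hg₁ : ∀ a b c, g a b c = g b a c := fun a b c ↦ baseIndicator_swap_left a.1 b.1 c.1
  have hg₂ : ∀ a b c, g a b c = g a c b := fun a b c ↦ baseIndicator_swap_right a.1 b.1 c.1
  let u : N → ℝ := fun e ↦ if e.1 ∈ S then y e else 0
  let w : N → ℝ := fun e ↦ if e.1 ∈ S then 0 else y e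
  have hwuu : triForm g w u u = triForm g u u w := by
    rw [triForm_swap_left hg₁, triForm_swap_right hg₂]
  have huwu : triForm g u w u = triForm g u u w := triForm_swap_right hg₂ ..
  have hwuw : triForm g w u w = triForm g u w w := triForm_swap_left hg₁ ..
  have hwwu : triForm g w w u = triForm g u w w := by rw [triForm_swap_right hg₂, hwuw]
  have hcube : ∀ s t : ℝ, triForm g (s • u + t • w) (s • u + t • w) (s • u + t • w) =
      s ^ 3 * triForm g u u u + 3 * (s ^ 2 * t) * triForm g u u w +
        3 * (s * t ^ 2) * triForm g u w w + t ^ 3 * triForm g w w w := fun s t ↦ by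
    simp only [triForm_add_smul, triForm_add_smul_mid hg₂, triForm_add_smul_left hg₁ hg₂,
      hwuu, huwu, hwuw, hwwu]
    ring
  have hsum : ∀ s t : ℝ, triForm g (s • u + t • w) (s • u + t • w) (s • u + t • w) =
      6 * ∑ j ∈ Finset.range 4, s ^ j * t ^ (3 - j) * M.weightedBaseSum S j y := fun s t ↦ by
    rw [← sum_isBase_prod_ite hM, ← hbases, ← triForm_baseIndicator_self hM]
    have : s • u + t • w = fun a : N ↦ if a.1 ∈ S then s * y a else t * y a := by
      ext a
      simp only [u, w, Pi.add_apply, Pi.smul_apply, smul_eq_mul]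
      split_ifs <;> simp
    rw [this]
  have key := fun s t : ℝ ↦ (hcube s t).symm.trans (hsum s t)
  simp only [Finset.sum_range_succ, Finset.sum_range_zero] at key
  -- Four values determine the four coefficients of the binary cubic.
  have k₁ := key 1 0
  have k₂ := key 0 1
  have k₃ := key 1 1
  have k₄ := key 1 (-1)
  norm_num at k₁ k₂ k₃ k₄
  -- $u$ vanishes off $S$, while the inequality needs a positive base vector; hence the perturbation
  -- by $\varepsilon w$ and the limit $\varepsilon\to0^+$.
  have hpos : ∀ ε : ℝ, 0 < ε → triForm g (u + ε • w) (u + ε • w) (u + ε • w) *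
      triForm g (u + ε • w) w w ≤ triForm g (u + ε • w) (u + ε • w) w ^ 2 := fun ε hε ↦
    triForm_baseIndicator_mul_le_sq hM hN _ (fun e ↦ by
      have := hy e ((hN e).1 e.2).mem_ground
      simp only [u, w, Pi.add_apply, Pi.smul_apply, smul_eq_mul]
      split_ifs
      · simpa
      · simpa using mul_pos hε this) w
  have hlim : triForm g u u u * triForm g u w w ≤ triForm g u u w ^ 2 := by
    have hε : ∀ ε : ℝ, 0 < ε →
        (triForm g u u u + 3 * ε * triForm g u u w + 3 * ε ^ 2 * triForm g u w w +
          ε ^ 3 * triForm g w w w) * (triForm g u w w + ε * triForm g w w w) ≤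
        (triForm g u u w + 2 * ε * triForm g u w w + ε ^ 2 * triForm g w w w) ^ 2 := fun ε h ↦ by
      have h' := hpos ε h
      rw [← one_smul ℝ u] at h'
      simp only [triForm_add_smul, triForm_add_smul_mid hg₂, triForm_add_smul_left hg₁ hg₂,
        hwuu, huwu, hwuw, hwwu] at h'
      refine le_trans (le_of_eq ?_) (h'.trans (le_of_eq ?_)) <;> ring
    have h := le_of_tendsto_of_tendsto (b := nhdsWithin (0 : ℝ) (Set.Ioi 0))
      ((Continuous.tendsto (by fun_prop) 0).mono_left nhdsWithin_le_nhds)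
      ((Continuous.tendsto (by fun_prop) 0).mono_left nhdsWithin_le_nhds)
      (Filter.eventually_of_mem self_mem_nhdsWithin hε)
    simpa using h
  -- The constant 3 arises here: $6M_3\cdot2M_1\le(2M_2)^2$.
  have m₃ : triForm g u u u = 6 * M.weightedBaseSum S 3 y := by linarith
  have m₂ : triForm g u u w = 2 * M.weightedBaseSum S 2 y := by linarith
  have m₁ : triForm g u w w = 2 * M.weightedBaseSum S 1 y := by linarith
  rw [m₃, m₂, m₁] at hlim
  linarith

open Classical in
theorem weightedBaseSum_sdiff (hM : M.eRank = 3) (S : Finset α) {j : ℕ} (hj : j ≤ 3) (y : α → ℝ) :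
    M.weightedBaseSum (M.ground_finite.toFinset \ S) j y = M.weightedBaseSum S (3 - j) y := by
  unfold weightedBaseSum
  refine Finset.sum_congr (Finset.filter_congr fun B hB ↦ and_congr_right fun hB' ↦ ?_)
    fun _ _ ↦ rfl
  have hcard := Finset.card_inter_add_card_sdiff B S
  rw [hB'.card_eq_three hM] at hcard
  rw [Finset.mem_powerset] at hB
  rw [← Finset.inter_sdiff_assoc, Finset.inter_eq_left.2 hB]
  constructor <;> intro h <;> omega

theorem sqrtBLC_of_eRank_eq_three (hM : M.eRank = 3) : M.SqrtBLC := by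
  classical
  intro m _ y hy S _ _ j hj hjS hne
  have hfac : 1 + 1 / ((min j (S.card - j) : ℕ) : ℝ) ≤ 2 := by
    have h1 : (1 : ℝ) ≤ ((min j (S.card - j) : ℕ) : ℝ) := by
      exact_mod_cast le_min hj (by omega)
    have := div_le_one_of_le₀ h1 (by positivity)
    linarith
  have hprod := mul_nonneg (weightedBaseSum_nonneg hy S (j - 1)) (weightedBaseSum_nonneg hy S (j + 1))
  have hle : 3 * (M.weightedBaseSum S (j - 1) y * M.weightedBaseSum S (j + 1) y) ≤
      M.weightedBaseSum S j y ^ 2 := by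
    rcases (by omega : j = 1 ∨ j = 2 ∨ 3 ≤ j) with rfl | rfl | h
    · have h := three_mul_weightedBaseSum_le_sq hM hy (M.ground_finite.toFinset \ S)
      rw [weightedBaseSum_sdiff hM S (by norm_num), weightedBaseSum_sdiff hM S (by norm_num),
        weightedBaseSum_sdiff hM S (by norm_num)] at h
      norm_num at h ⊢
      linarith
    · exact three_mul_weightedBaseSum_le_sq hM hy S
    · rw [weightedBaseSum_eq_zero_of_lt hM S (by omega : 3 < j + 1), mul_zero, mul_zero]
      positivity
  have hsq : 0 < M.weightedBaseSum S j y ^ 2 := by positivity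
  nlinarith [mul_le_mul_of_nonneg_right hfac hprod]

/-! ### Duality -/

-- Complementation sends bases to dual bases, and the weight of $B$ is the total product times the
-- inverse weights over $E\setminus B$.
open Classical in
theorem weightedBaseSum_eq_prod_mul_dual {y : α → ℝ} (hy : ∀ e ∈ M.E, 0 < y e) {S : Finset α}
    (hS : (S : Set α) ⊆ M.E) {i j : ℕ} (hij : i + j = S.card) :
    M.weightedBaseSum S i y =
      (∏ e ∈ M.ground_finite.toFinset, y e) * M.dual.weightedBaseSum S j (fun e ↦ (y e)⁻¹) := by
  unfold weightedBaseSum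
  set E := M.ground_finite.toFinset with hE
  have hEE : (E : Set α) = M.E := M.ground_finite.coe_toFinset
  have hE' : M.dual.ground_finite.toFinset = E := by
    ext; simp [hE]
  have hSE : S ⊆ E := by rwa [← Finset.coe_subset, hEE]
  rw [hE', Finset.mul_sum]
  have hcard : ∀ B : Finset α, (B ∩ S).card + ((E \ B) ∩ S).card = S.card := fun B ↦ by
    have h1 : (E \ B) ∩ S = S \ B := by
      ext e
      simp only [Finset.mem_inter, Finset.mem_sdiff]
      exact ⟨fun h ↦ ⟨h.2, h.1.2⟩, fun h ↦ ⟨⟨hSE h.1, h.2⟩, h.1⟩⟩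
    rw [h1, Finset.inter_comm, Finset.card_inter_add_card_sdiff]
  refine Finset.sum_nbij' (fun B ↦ E \ B) (fun B ↦ E \ B) ?_ ?_ ?_ ?_ ?_
  · intro B hB
    simp only [Finset.mem_filter, Finset.mem_powerset] at hB ⊢
    refine ⟨Finset.sdiff_subset, ?_, ?_⟩
    · rw [Finset.coe_sdiff, hEE]
      exact hB.2.1.compl_isBase_dual
    · have := hcard B
      omega
  · intro B hB
    simp only [Finset.mem_filter, Finset.mem_powerset] at hB ⊢
    refine ⟨Finset.sdiff_subset, ?_, ?_⟩
    · rw [Finset.coe_sdiff, hEE]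
      exact hB.2.1.compl_isBase_of_dual
    · have := hcard B
      omega
  · intro B hB
    simp only [Finset.mem_filter, Finset.mem_powerset] at hB
    exact Finset.sdiff_sdiff_eq_self hB.1
  · intro B hB
    simp only [Finset.mem_filter, Finset.mem_powerset] at hB
    exact Finset.sdiff_sdiff_eq_self hB.1
  · intro B hB
    simp only [Finset.mem_filter, Finset.mem_powerset] at hB
    have hne : ∏ e ∈ E \ B, y e ≠ 0 := Finset.prod_ne_zero_iff.2 fun e he ↦
      (hy e (hEE ▸ Finset.mem_coe.2 (Finset.sdiff_subset he))).ne'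
    rw [← Finset.prod_sdiff hB.1, Finset.prod_inv_distrib]
    field_simp

/-- The substitution $j\mapsto n-j$ preserves $\min(j,n-j)$ and swaps the two neighbours of $j$;
both sides scale by $P^2$. -/
theorem SqrtBLC.of_dual (h : M.dual.SqrtBLC) : M.SqrtBLC := by
  intro m hm y hy S hS hSm j hj hjS hne
  set P := ∏ e ∈ M.ground_finite.toFinset, y e with hP
  have hP0 : 0 < P := Finset.prod_pos fun e he ↦ hy e (by simpa using he)
  have e₀ : M.weightedBaseSum S j y = P * M.dual.weightedBaseSum S (S.card - j) _ :=
    weightedBaseSum_eq_prod_mul_dual hy hS (by omega)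
  have e₁ : M.weightedBaseSum S (j - 1) y = P * M.dual.weightedBaseSum S (S.card - j + 1) _ :=
    weightedBaseSum_eq_prod_mul_dual hy hS (by omega)
  have e₂ : M.weightedBaseSum S (j + 1) y = P * M.dual.weightedBaseSum S (S.card - j - 1) _ :=
    weightedBaseSum_eq_prod_mul_dual hy hS (by omega)
  have key := h m hm (fun e ↦ (y e)⁻¹) (fun e he ↦ inv_pos.2 (hy e he)) S hS hSm (S.card - j)
    (by omega) (by omega) (fun h0 ↦ hne (by rw [e₀, h0, mul_zero]))
  rw [show S.card - (S.card - j) = j by omega, min_comm] at key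
  rw [e₀, e₁, e₂]
  nlinarith [mul_lt_mul_of_pos_left key (pow_pos hP0 2)]

end Matroid

theorem theorem5p2 {α : Type*} (M : Matroid α) [M.Finite]
    (hM : M.eRank = 3 ∨ M.dual.eRank = 3) : M.SqrtBLC :=
  hM.elim Matroid.sqrtBLC_of_eRank_eq_three fun h ↦ (Matroid.sqrtBLC_of_eRank_eq_three h).of_dual
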